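/- Let $U_1,U_2,\ldots$ be a (strictly) stationary sequence of real random variables on a probability space, with $U_j\in[0,B]$ almost surely for all $j$. For $\tau\in\{1,2,\ldots\}$ let $$\alpha(\tau)=\sup_{t\ge 1}\ \sup\bigl\{|\mathbb P(A\cap A')-\mathbb P(A)\mathbb P(A')| : A\in\sigma(U_1,\ldots,U_t),\ A'\in\sigma(U_{t+\tau},U_{t+\tau+1},\ldots)\bigr\},$$ assume that the process is exponentially $\alpha$-mixing, i.e. there are $\mu>0$ and $\rho\in(0,1)$ with $\alpha(\tau)\le\mu\rho^\tau$ for all $\tau\ge1$ (such a process is automatically ergodic), and let $\mathsf{t_{mix}}(\eta)=\min\{\tau\in\{1,2,\ldots\}:\alpha(\tau)\le\eta\}$ for $\eta>0$. Let $n\ge1$ be an integer and let $\delta,\epsilon>0$; write $\log$ for the natural logarithm. (a) For each integer $\tau\ge\mathsf{t_{mix}}(\epsilon/n)$, with $v^2=\frac1{\tau^2}\mathrm{var}\bigl(\sum_{j=1}^{\tau}U_j\bigr)$, $$\Bigl|\mathbb E[U_1]-\frac1n\sum_{j=1}^nU_j\Bigr|\le\sqrt{\frac{4\tau v^2\log(1/\delta)}{n}}+\frac{4B\tau\log(1/\delta)}{3n}$$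 with probability at least $1-4\delta-\epsilon$. (b) If $n\ge24\,\mathsf{t_{mix}}(\epsilon/n)$, then with probability at least $1-10\delta-2\epsilon$ the following implication holds: if $\sum_{j=1}^nU_j\ge36B\log(2/\delta)\,\mathsf{t_{mix}}(\epsilon/n)$, then $$\Bigl|\mathbb E[U_1]-\frac1n\sum_{j=1}^nU_j\Bigr|\le82\cdot\frac{\sqrt{B\log(2/\delta)\,\bigl(\sum_{j=1}^nU_j\bigr)\,\mathsf{t_{mix}}(\epsilon/n)}}{n}.$$ (Where $\delta$ is so large that a logarithm is negative, the probability lower bounds are negative and there is nothing to prove.) -/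

import Mathlib

open MeasureTheory ProbabilityTheory

/-- The past of the process `U` up to time `t`: the σ-algebra generated by `U i`, `i ≤ t`. -/
@[reducible] def pastSigma {Ω E : Type*} [MeasurableSpace E] (U : ℕ → Ω → E) (t : ℕ) : MeasurableSpace Ω :=
  ⨆ (i : ℕ) (_ : i ≤ t), MeasurableSpace.comap (U i) inferInstance

/-- The future of the process `U` from time `t` on: the σ-algebra generated by `U i`, `t ≤ i`. -/
@[reducible] def futureSigma {Ω E : Type*} [MeasurableSpace E] (U : ℕ → Ω → E) (t : ℕ) : MeasurableSpace Ω :=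
  ⨆ (i : ℕ) (_ : t ≤ i), MeasurableSpace.comap (U i) inferInstance

/-- The `α`-mixing coefficient at lag `τ`: the supremum, over all times `t`, all events `A` of the
past up to `t` and all events `B` of the future from `t + τ` on, of `|P(A ∩ B) - P(A) P(B)|`.
For a probability measure these numbers lie in `[0, 1]`, so this is a genuine supremum. -/
noncomputable def alphaCoeff {Ω E : Type*} [MeasurableSpace Ω] [MeasurableSpace E]
    (P : Measure Ω) (U : ℕ → Ω → E) (τ : ℕ) : ℝ :=
  sSup {x : ℝ | ∃ (t : ℕ) (A B : Set Ω),
    MeasurableSet[pastSigma U t] A ∧ MeasurableSet[futureSigma U (t + τ)] B ∧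
      x = |P.real (A ∩ B) - P.real A * P.real B|}

/-- Exponential `α`-mixing with parameters `μ > 0` and `ρ ∈ (0, 1)`:
`α(τ) ≤ μ ρ ^ τ` for all `τ ≥ 1`. -/
structure IsExpAlphaMixing {Ω E : Type*} [MeasurableSpace Ω] [MeasurableSpace E]
    (P : Measure Ω) (U : ℕ → Ω → E) (μ ρ : ℝ) : Prop where
  mu_pos : 0 < μ
  rho_pos : 0 < ρ
  rho_lt_one : ρ < 1
  bound : ∀ τ : ℕ, 1 ≤ τ → alphaCoeff P U τ ≤ μ * ρ ^ τ

/-- The mixing time to level `ε`: the least `τ ∈ {1, 2, …}` with `α(τ) ≤ ε`. (For an exponentially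
`α`-mixing process and `ε > 0` such a `τ` exists.) -/
noncomputable def mixingTime {Ω E : Type*} [MeasurableSpace Ω] [MeasurableSpace E]
    (P : Measure Ω) (U : ℕ → Ω → E) (ε : ℝ) : ℕ :=
  sInf {τ : ℕ | 1 ≤ τ ∧ alphaCoeff P U τ ≤ ε}

/-- (Strict) stationarity: the shifted process `(U 1, U 2, …)` has the same law, on the sequence
space with its product σ-algebra, as `(U 0, U 1, …)`. -/
def IsStationaryProcess {Ω E : Type*} [MeasurableSpace Ω] [MeasurableSpace E]
    (P : Measure Ω) (U : ℕ → Ω → E) : Prop :=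
  P.map (fun ω (i : ℕ) => U (i + 1) ω) = P.map (fun ω (i : ℕ) => U i ω)

/-- The normalized block variance `v² = τ⁻² var(U 0 + ⋯ + U (τ - 1))`. -/
noncomputable def blockVariance {Ω : Type*} [MeasurableSpace Ω]
    (P : Measure Ω) (U : ℕ → Ω → ℝ) (τ : ℕ) : ℝ :=
  1 / (τ : ℝ) ^ 2 * variance (fun ω => ∑ j ∈ Finset.range τ, U j ω) P

/-!
Write `e = E[U₀]`, `a = ε / n`, `L = log (1 / δ)` and cut `{0, …, n - 1}` into `q = ⌊n / τ⌋` blocks of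
length `τ`, with centred block sums `Wᵢ` (`blockDev`). The fewer than `τ` remaining terms move the
total deviation by at most `(τ - 1) B`.

Under `α`-mixing, the law of several blocks need not be close in total variation to a product law,
and the covariance inequality applied to `exp (t ∑ Wᵢ)` costs a factor of the size of the exponential.
The exponential is therefore replaced by the bounded potential `sigmoid (c + t ∑ Wᵢ - m ψ)`, which
is `z / (1 + z)` at `z = exp (c + t ∑ Wᵢ - m ψ)`. Two properties make it work:

* `z ↦ z / (1 + z)` is concave, so adding an independent increment `Y` with `E[exp Y] ≤ 1` does not
  increase the expected potential (`integral_sigmoid_add_le_of_integral_exp_le`);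
* `sigmoid' ≤ 1 / 4`, so replacing the independent increment by one that is only `α`-mixed with the
  past, and lies in an interval of length `b`, costs at most `a b / 4`
  (`AlphaClose.integral_sigmoid_add_le`).

Hence every block adds at most `a t τ B / 4` to the expected potential, which starts below `exp c`
(`integral_sigmoid_blockDev_le`). The parameter `t`, with `t τ B ≤ 1 / κ`, comes from Bernstein's bound
on the moment generating function (`exists_bernstein_exponent`).

For `τ ≥ 2` the blocks with even and with odd index are treated separately, which leaves a gap of
length `τ` between consecutive blocks. If the total deviation is large, then the arguments of the
two potentials have a large sum, and this alone makes one of the two pairs of potentials (for `W` and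
for `-W`) add up to at least `3 / 4`. With `t τ B ≤ 3`, Markov's inequality gives a failure probability
of at most `4 δ + 2 q a ≤ 4 δ + ε`. For `τ = 1` consecutive blocks are already at the right distance,
a single class with `t B ≤ 1` is enough, and the bound is `4 δ + n a = 4 δ + ε`.

Part (b) follows from part (a) with `τ` the mixing time, since the block variance is at most `B e`:
writing `A` for `B log (2 / δ)` times the mixing time and `S = ∑ Uⱼ`, the bound
`|S - n e| ≤ 2 √(A n e) + 4 A / 3` can be solved for `n e` when `S ≥ 36 A`
(`abs_sub_le_of_self_bounding`).
-/

/-! ### The logistic function -/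

theorem sigmoid_mul_one_sub_mem (x : ℝ) :
    0 ≤ Real.sigmoid x * (1 - Real.sigmoid x) ∧ Real.sigmoid x * (1 - Real.sigmoid x) ≤ 1 / 4 :=
  ⟨mul_nonneg (Real.sigmoid_nonneg x) (by linarith [Real.sigmoid_le_one x]),
    by nlinarith [sq_nonneg (Real.sigmoid x - 1 / 2)]⟩

theorem sigmoid_eq_exp_div (x : ℝ) : Real.sigmoid x = Real.exp x / (1 + Real.exp x) := by
  have := Real.exp_pos x
  rw [Real.sigmoid_def, Real.exp_neg]
  field_simp
  ring

theorem sigmoid_le_exp (x : ℝ) : Real.sigmoid x ≤ Real.exp x := by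
  have := Real.exp_pos (-x)
  rw [Real.sigmoid_def, ← neg_neg x, Real.exp_neg (-x), neg_neg]
  exact inv_anti₀ this (by linarith)

/-- The tangent bound for the concave function `z ↦ z / (1 + z)`, at `z = exp x`. -/
theorem sigmoid_add_le (x y : ℝ) : Real.sigmoid (x + y) ≤
    Real.sigmoid x + Real.sigmoid x * (1 - Real.sigmoid x) * (Real.exp y - 1) := by
  have hx := Real.exp_pos x
  have hy := Real.exp_pos y
  rw [sigmoid_eq_exp_div, sigmoid_eq_exp_div, Real.exp_add]
  set p := Real.exp x
  set q := Real.exp y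
  rw [← sub_nonneg]
  have : p / (1 + p) + p / (1 + p) * (1 - p / (1 + p)) * (q - 1) - p * q / (1 + p * q) =
     p ^ 2 * (q - 1) ^ 2 / ((1 + p) ^ 2 * (1 + p * q)) := by
    field_simp; ring
  rw [this]; positivity

theorem one_half_le_sigmoid {x : ℝ} (hx : 0 ≤ x) : 1 / 2 ≤ Real.sigmoid x := by
  have := Real.sigmoid_le hx
  rw [Real.sigmoid_zero] at this
  linarith

/-- Only the sum of the two arguments matters: with `p = exp x` and `q = exp y` the left side is
`(p + q + 2 p q) / (1 + p + q + p q)`, and `p + q ≥ 2 √(p q)`. -/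
theorem three_quarters_le_sigmoid_add_sigmoid {x y : ℝ} (h : 2 * Real.log (3 / 5) ≤ x + y) :
    3 / 4 ≤ Real.sigmoid x + Real.sigmoid y := by
  have hx := Real.exp_pos x
  have hy := Real.exp_pos y
  have hp : 9 / 25 ≤ Real.exp x * Real.exp y := by
    rw [← Real.exp_add, show (9 / 25 : ℝ) = Real.exp (2 * Real.log (3 / 5)) by
      rw [two_mul, Real.exp_add, Real.exp_log (by norm_num)]; norm_num]
    exact Real.exp_le_exp.2 h
  rw [sigmoid_eq_exp_div, sigmoid_eq_exp_div]
  set p := Real.exp x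
  set q := Real.exp y
  have hs : 6 / 5 ≤ p + q := by nlinarith [sq_nonneg (p - q)]
  rw [div_add_div _ _ (by positivity) (by positivity), div_le_div_iff₀ (by norm_num) (by positivity)]
  nlinarith

theorem sigmoid_add_eq_integral {x l b y : ℝ} (hy : y ∈ Set.Icc l (l + b)) :
    Real.sigmoid (x + y) = Real.sigmoid (x + l) + ∫ u in Set.Ioc l (l + b),
      Real.sigmoid (x + u) * (1 - Real.sigmoid (x + u)) * (Set.Iio y).indicator 1 u := by
  have h1 : ∀ u, HasDerivAt (fun u => Real.sigmoid (x + u))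
      (Real.sigmoid (x + u) * (1 - Real.sigmoid (x + u))) u := fun u => by
    simpa [Function.comp_def] using
      (Real.hasDerivAt_sigmoid (x + u)).comp u ((hasDerivAt_id u).const_add x)
  have hc : Continuous fun u => Real.sigmoid (x + u) * (1 - Real.sigmoid (x + u)) := by
    have := continuous_sigmoid
    fun_prop
  have h2 := intervalIntegral.integral_eq_sub_of_hasDerivAt (a := l) (b := y)
    (fun u _ => h1 u) (hc.intervalIntegrable _ _)
  rw [intervalIntegral.integral_of_le hy.1] at h2
  have h3 : ∫ u in Set.Ioc l (l + b),
      Real.sigmoid (x + u) * (1 - Real.sigmoid (x + u)) * (Set.Iio y).indicator 1 u =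
      ∫ u in Set.Ioc l y, Real.sigmoid (x + u) * (1 - Real.sigmoid (x + u)) := by
    have : ∀ u, Real.sigmoid (x + u) * (1 - Real.sigmoid (x + u)) * (Set.Iio y).indicator 1 u =
      (Set.Iio y).indicator (fun u => Real.sigmoid (x + u) * (1 - Real.sigmoid (x + u))) u := by
      intro u; by_cases hu : u ∈ Set.Iio y <;> simp [hu]
    simp_rw [this]
    rw [setIntegral_indicator measurableSet_Iio, integral_Ioc_eq_integral_Ioo (y := y)]
    congr 2
    ext u
    simp only [Set.mem_inter_iff, Set.mem_Ioc, Set.mem_Iio, Set.mem_Ioo]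
    exact ⟨fun h => ⟨h.1.1, h.2⟩, fun h => ⟨⟨h.1, h.2.le.trans hy.2⟩, h.2⟩⟩
  rw [h3, h2]; ring

/-! ### The logistic potential along a mixing sequence -/

/-- The `α`-mixing condition at level `a` between two σ-algebras, imposed event by event. Neither
σ-algebra is required to be a sub-σ-algebra of the ambient one. -/
def AlphaClose {Ω : Type*} [MeasurableSpace Ω] (P : Measure Ω) (𝓕 𝓖 : MeasurableSpace Ω)
    (a : ℝ) : Prop :=
  ∀ A A' : Set Ω, MeasurableSet[𝓕] A → MeasurableSet[𝓖] A' →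
    |P.real (A ∩ A') - P.real A * P.real A'| ≤ a

/-- The covariance inequality under `α`-mixing between a bounded function of the past and a future
event, by the layer-cake formula. -/
theorem AlphaClose.setIntegral_le {Ω : Type*} {𝓕 𝓖 mΩ : MeasurableSpace Ω}
    {P : Measure Ω} [IsProbabilityMeasure P] {a : ℝ} (h : AlphaClose P 𝓕 𝓖 a)
    (h𝓕 : 𝓕 ≤ mΩ) {f : Ω → ℝ} (hf : Measurable[𝓕] f) {M : ℝ}
    (hf0 : ∀ ω, 0 ≤ f ω) (hfM : ∀ ω, f ω ≤ M) {A : Set Ω} (hA : MeasurableSet[𝓖] A) :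
    ∫ ω in A, f ω ∂P ≤ (∫ ω, f ω ∂P) * P.real A + M * a := by
  obtain ⟨ω₀⟩ : Nonempty Ω := nonempty_of_isProbabilityMeasure P
  have hM : 0 ≤ M := (hf0 ω₀).trans (hfM ω₀)
  have hint : Integrable f P := Integrable.of_bound (hf.mono h𝓕 le_rfl).aestronglyMeasurable M
    (.of_forall fun ω => by rw [Real.norm_eq_abs, abs_of_nonneg (hf0 ω)]; exact hfM ω)
  have anti : ∀ Q : Measure Ω, IsFiniteMeasure Q →
      IntegrableOn (fun t => Q.real {ω | t ≤ f ω}) (Set.Ioc 0 M) := fun Q _ => by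
    have : Antitone fun t => Q.real {ω | t ≤ f ω} :=
      fun s t hst => measureReal_mono fun ω (hω : t ≤ f ω) => hst.trans hω
    exact (this.intervalIntegrable (a := 0) (b := M)).1
  rw [hint.restrict.integral_eq_integral_Ioc_meas_le (.of_forall hf0) (.of_forall hfM),
    hint.integral_eq_integral_Ioc_meas_le (.of_forall hf0) (.of_forall hfM),
    ← integral_mul_const]
  have hc : ∫ _ in Set.Ioc 0 M, a = M * a := by simp [hM]
  rw [← hc, ← integral_add ((anti P inferInstance).mul_const _) (by simp)]
  refine setIntegral_mono (anti _ inferInstance)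
    (((anti P inferInstance).mul_const _).add (by simp)) fun t => ?_
  have hs : MeasurableSet[𝓕] {ω | t ≤ f ω} := hf measurableSet_Ici
  have := (abs_le.1 (h _ _ hs hA)).2
  simp only [measureReal_restrict_apply (h𝓕 _ hs)]
  linarith

/-- An exact formula for `E[sigmoid (X + Y)]` through the events `{u < Y}`. No relation between `X`
and `Y` is assumed, so it holds both for a dependent pair and for independent copies of its members.
-/
theorem integral_sigmoid_add_eq {Ω : Type*} [MeasurableSpace Ω] {P : Measure Ω}
    [IsProbabilityMeasure P] {X Y : Ω → ℝ} (hX : Measurable X) (hY : Measurable Y) {l b : ℝ}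
    (hYb : ∀ᵐ ω ∂P, Y ω ∈ Set.Icc l (l + b)) :
    IntegrableOn (fun u => ∫ ω in {ω | u < Y ω},
        Real.sigmoid (X ω + u) * (1 - Real.sigmoid (X ω + u)) ∂P) (Set.Ioc l (l + b)) ∧
    ∫ ω, Real.sigmoid (X ω + Y ω) ∂P = ∫ ω, Real.sigmoid (X ω + l) ∂P +
      ∫ u in Set.Ioc l (l + b), ∫ ω in {ω | u < Y ω},
        Real.sigmoid (X ω + u) * (1 - Real.sigmoid (X ω + u)) ∂P := by
  have hc := continuous_sigmoid.measurable
  set F : Ω × ℝ → ℝ := fun z => {z : Ω × ℝ | z.2 < Y z.1}.indicator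
    (fun z => Real.sigmoid (X z.1 + z.2) * (1 - Real.sigmoid (X z.1 + z.2))) z with hF
  have hFm : Measurable F := by
    refine Measurable.indicator (by fun_prop) (measurableSet_lt measurable_snd ?_)
    fun_prop
  have hFi : Integrable F (P.prod (volume.restrict (Set.Ioc l (l + b)))) := by
    refine Integrable.of_bound hFm.aestronglyMeasurable (1 / 4) (.of_forall fun z => ?_)
    obtain ⟨h0, h1⟩ := sigmoid_mul_one_sub_mem (X z.1 + z.2)
    rw [Real.norm_eq_abs, hF]
    by_cases hz : z.2 < Y z.1
    · simpa [Set.indicator, hz, abs_of_nonneg h0] using h1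
    · simp [Set.indicator, hz]
  have key : ∀ u, ∫ ω in {ω | u < Y ω},
      Real.sigmoid (X ω + u) * (1 - Real.sigmoid (X ω + u)) ∂P = ∫ ω, F (ω, u) ∂P := fun u => by
    rw [← integral_indicator (measurableSet_lt measurable_const hY)]
    rfl
  simp_rw [key]
  refine ⟨hFi.integral_prod_right, ?_⟩
  rw [← integral_integral_swap (f := fun ω u => F (ω, u)) hFi, ← integral_add]
  · refine integral_congr_ae (hYb.mono fun ω hω => ?_)
    simp only [sigmoid_add_eq_integral hω]
    congr 2 with u
    by_cases hu : u < Y ω <;> simp [hF, Set.indicator, hu]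
  · exact Integrable.of_bound (by fun_prop) 1 (.of_forall fun ω => by
      rw [Real.norm_eq_abs, abs_of_nonneg (Real.sigmoid_nonneg _)]; exact Real.sigmoid_le_one _)
  · exact hFi.integral_prod_left

theorem integrable_sigmoid {Ω : Type*} [MeasurableSpace Ω] {P : Measure Ω}
    [IsProbabilityMeasure P] {X : Ω → ℝ} (hX : Measurable X) :
    Integrable (fun ω => Real.sigmoid (X ω)) P :=
  Integrable.of_bound (continuous_sigmoid.measurable.comp hX).aestronglyMeasurable 1
    (.of_forall fun ω => by
      rw [Real.norm_eq_abs, abs_of_nonneg (Real.sigmoid_nonneg _)]; exact Real.sigmoid_le_one _)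

/-- Supermartingale property of the potential: the increment `Y` is averaged with the state `x` held
fixed, i.e. as if it were independent of the past. -/
theorem integral_sigmoid_add_le_of_integral_exp_le {Ω : Type*} [MeasurableSpace Ω] {P : Measure Ω}
    [IsProbabilityMeasure P] {Y : Ω → ℝ} (hY : Measurable Y)
    (hYi : Integrable (fun ω => Real.exp (Y ω)) P)
    (hYe : ∫ ω, Real.exp (Y ω) ∂P ≤ 1) (x : ℝ) :
    ∫ ω, Real.sigmoid (x + Y ω) ∂P ≤ Real.sigmoid x := by
  have hi : Integrable (fun ω => Real.sigmoid x * (1 - Real.sigmoid x) * (Real.exp (Y ω) - 1)) P :=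
    (hYi.sub (integrable_const 1)).const_mul (Real.sigmoid x * (1 - Real.sigmoid x))
  calc ∫ ω, Real.sigmoid (x + Y ω) ∂P
      ≤ ∫ ω, (Real.sigmoid x + Real.sigmoid x * (1 - Real.sigmoid x) * (Real.exp (Y ω) - 1)) ∂P :=
        integral_mono (integrable_sigmoid (hY.const_add x)) ((integrable_const _).add hi)
          fun ω => sigmoid_add_le x (Y ω)
    _ = Real.sigmoid x + Real.sigmoid x * (1 - Real.sigmoid x) *
          (∫ ω, Real.exp (Y ω) ∂P - 1) := by
        rw [integral_add (integrable_const _) hi, integral_const_mul,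
          integral_sub hYi (integrable_const _)]
        simp
    _ ≤ Real.sigmoid x := by
        nlinarith [(sigmoid_mul_one_sub_mem x).1]

/-- An increment `Y` with `E[exp Y] ≤ 1`, lying in an interval of length `b`, raises the expected
potential by at most `a b / 4`. The formula `integral_sigmoid_add_eq` is compared under `P` and, for
an independent pair, under `P.prod P`. -/
theorem AlphaClose.integral_sigmoid_add_le {Ω : Type*} {𝓕 𝓖 mΩ : MeasurableSpace Ω}
    {P : Measure Ω} [IsProbabilityMeasure P] {a : ℝ} (h : AlphaClose P 𝓕 𝓖 a)
    (h𝓕 : 𝓕 ≤ mΩ) (h𝓖 : 𝓖 ≤ mΩ) {X Y : Ω → ℝ} (hX : Measurable[𝓕] X) (hY : Measurable[𝓖] Y)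
    {l b : ℝ} (hb : 0 ≤ b) (hYb : ∀ᵐ ω ∂P, Y ω ∈ Set.Icc l (l + b))
    (hYe : ∫ ω, Real.exp (Y ω) ∂P ≤ 1) :
    ∫ ω, Real.sigmoid (X ω + Y ω) ∂P ≤ ∫ ω, Real.sigmoid (X ω) ∂P + a * b / 4 := by
  have hXm : Measurable X := hX.mono h𝓕 le_rfl
  have hYm : Measurable Y := hY.mono h𝓖 le_rfl
  have hYi : Integrable (fun ω => Real.exp (Y ω)) P :=
    Integrable.of_bound (by fun_prop) (Real.exp (l + b)) (hYb.mono fun ω hω => by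
      rw [Real.norm_eq_abs, Real.abs_exp]; exact Real.exp_le_exp.2 hω.2)
  obtain ⟨hi₁, e₁⟩ := integral_sigmoid_add_eq hXm hYm hYb
  have hYb' : ∀ᵐ z ∂(P.prod P), Y z.2 ∈ Set.Icc l (l + b) :=
    Measure.quasiMeasurePreserving_snd.ae hYb
  obtain ⟨hi₂, e₂⟩ := integral_sigmoid_add_eq (P := P.prod P) (hXm.comp measurable_fst)
    (hYm.comp measurable_snd) hYb'
  simp only [Function.comp_apply] at hi₂ e₂
  have e₃ : ∫ z, Real.sigmoid (X z.1 + l) ∂(P.prod P) = ∫ ω, Real.sigmoid (X ω + l) ∂P := by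
    simpa using integral_fun_fst (μ := P) (ν := P) (fun ω => Real.sigmoid (X ω + l))
  have e₄ : ∀ u, ∫ z in {z : Ω × Ω | u < Y z.2},
      Real.sigmoid (X z.1 + u) * (1 - Real.sigmoid (X z.1 + u)) ∂(P.prod P) =
      (∫ ω, Real.sigmoid (X ω + u) * (1 - Real.sigmoid (X ω + u)) ∂P) *
        P.real {ω | u < Y ω} := fun u => by
    have : {z : Ω × Ω | u < Y z.2} = Set.univ ×ˢ {ω | u < Y ω} := by ext; simp
    rw [this, ← Measure.prod_restrict, Measure.restrict_univ]
    rw [integral_fun_fst (fun ω => Real.sigmoid (X ω + u) * (1 - Real.sigmoid (X ω + u)))]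
    simp [mul_comm]
  have step : ∫ ω, Real.sigmoid (X ω + Y ω) ∂P ≤
      ∫ z, Real.sigmoid (X z.1 + Y z.2) ∂(P.prod P) + a * b / 4 := by
    have hconst : ∫ _ in Set.Ioc l (l + b), 1 / 4 * a = a * b / 4 := by
      simp [hb]; ring
    rw [e₁, e₂, e₃, ← hconst, add_assoc, ← integral_add hi₂ (integrable_const _)]
    refine add_le_add le_rfl ?_
    refine setIntegral_mono hi₁ (hi₂.add (integrable_const _)) fun u => ?_
    simp only [e₄]
    have hc := continuous_sigmoid.measurable
    have hcm : Measurable fun x => Real.sigmoid (x + u) * (1 - Real.sigmoid (x + u)) := by fun_prop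
    exact h.setIntegral_le h𝓕 (hcm.comp hX)
      (fun ω => (sigmoid_mul_one_sub_mem _).1) (fun ω => (sigmoid_mul_one_sub_mem _).2)
      (hY measurableSet_Ioi)
  have hprod : Integrable (fun z : Ω × Ω => Real.sigmoid (X z.1 + Y z.2)) (P.prod P) :=
    integrable_sigmoid (by fun_prop)
  refine step.trans ?_
  gcongr ?_ + _
  rw [integral_prod _ hprod]
  exact integral_mono hprod.integral_prod_left (integrable_sigmoid hXm)
    fun ω => integral_sigmoid_add_le_of_integral_exp_le hYm hYi hYe (X ω)

/-- Iteration of `AlphaClose.integral_sigmoid_add_le`: `𝓕 i` stands for the past before the `i`-th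
increment and `𝓖 i` for the information carried by that increment. -/
theorem integral_sigmoid_sum_le {Ω : Type*} [mΩ : MeasurableSpace Ω]
    {P : Measure Ω} [IsProbabilityMeasure P] {a l b c ψ : ℝ} (hb : 0 ≤ b) {Y : ℕ → Ω → ℝ}
    (𝓕 : ℕ → MeasurableSpace Ω) (𝓖 : ℕ → MeasurableSpace Ω) (h𝓕 : ∀ i, 𝓕 i ≤ mΩ)
    (h𝓖 : ∀ i, 𝓖 i ≤ mΩ) (hmono : Monotone 𝓕)
    (h : ∀ i, AlphaClose P (𝓕 i) (𝓖 i) a)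
    (hY𝓕 : ∀ i, Measurable[𝓕 (i + 1)] (Y i)) (hY𝓖 : ∀ i, Measurable[𝓖 i] (Y i))
    (hYb : ∀ i, ∀ᵐ ω ∂P, Y i ω ∈ Set.Icc l (l + b))
    (hYe : ∀ i, ∫ ω, Real.exp (Y i ω) ∂P ≤ Real.exp ψ) (m : ℕ) :
    ∫ ω, Real.sigmoid (c + (∑ i ∈ Finset.range m, Y i ω - m * ψ)) ∂P ≤
      Real.exp c + m * (a * b / 4) := by
  induction m with
  | zero => simpa using sigmoid_le_exp c
  | succ m ih =>
    have hS : Measurable[𝓕 m] fun ω => c + (∑ i ∈ Finset.range m, Y i ω - m * ψ) := by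
      refine Measurable.const_add (Measurable.sub_const (Finset.measurable_fun_sum _ fun i hi => ?_) _) _
      exact (hY𝓕 i).mono (hmono (Finset.mem_range.1 hi)) le_rfl
    have := (h m).integral_sigmoid_add_le (h𝓕 m) (h𝓖 m) hS ((hY𝓖 m).sub_const ψ) hb
      (l := l - ψ) ((hYb m).mono fun ω hω => ⟨by linarith [hω.1], by linarith [hω.2]⟩)
      (by
        simp_rw [Real.exp_sub]
        rw [integral_div, div_le_one (Real.exp_pos _)]
        exact hYe m)
    have e : ∀ ω, c + (∑ i ∈ Finset.range (m + 1), Y i ω - (m + 1 : ℕ) * ψ) =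
        c + (∑ i ∈ Finset.range m, Y i ω - m * ψ) + (Y m ω - ψ) := fun ω => by
      rw [Finset.sum_range_succ]; push_cast; ring
    simp_rw [e]
    push_cast
    linarith

/-! ### Bernstein's exponent -/

/-- Comparison of the exponential series with a geometric one, by `(k + 2)! ≥ 2 · 3 ^ k`. -/
theorem exp_le_one_add_add_sq {x c : ℝ} (hx : |x| ≤ c) (hc : c < 3) :
    Real.exp x ≤ 1 + x + x ^ 2 / (2 * (1 - c / 3)) := by
  have hc0 : 0 ≤ c := (abs_nonneg x).trans hx
  have h1 : HasSum (fun k : ℕ => x ^ k / (k.factorial : ℝ)) (Real.exp x) := by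
    rw [Real.exp_eq_exp_ℝ]; exact NormedSpace.expSeries_div_hasSum_exp x
  have h2 := (hasSum_nat_add_iff' 2).2 h1
  have h3 := (hasSum_geometric_of_lt_one (r := c / 3) (by positivity) (by linarith)).mul_left
    (x ^ 2 / 2)
  have h4 := hasSum_le (fun k => ?_) h2 h3
  · simp only [Finset.sum_range_succ, Finset.sum_range_zero, Nat.factorial] at h4
    have : x ^ 2 / (2 * (1 - c / 3)) = x ^ 2 / 2 * (1 - c / 3)⁻¹ := by
      rw [div_mul_eq_div_div, div_eq_mul_inv (x ^ 2 / 2)]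
    rw [this]
    norm_num at h4 ⊢
    linarith
  · have hf : 2 * 3 ^ k ≤ (k + 2).factorial := by
      have := Nat.factorial_mul_pow_le_factorial (m := 2) (n := k)
      simpa [Nat.add_comm] using this
    have hf' : (2 * 3 ^ k : ℝ) ≤ ((k + 2).factorial : ℝ) := by exact_mod_cast hf
    calc x ^ (k + 2) / ((k + 2).factorial : ℝ) ≤ |x| ^ (k + 2) / ((k + 2).factorial : ℝ) := by
          gcongr ?_ / _
          exact (le_abs_self _).trans (abs_pow x _).le
      _ ≤ (x ^ 2 * c ^ k) / (2 * 3 ^ k) := by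
          rw [pow_add, mul_comm, sq_abs]
          gcongr
      _ = x ^ 2 / 2 * (c / 3) ^ k := by rw [div_pow]; field_simp

/-- Bernstein's bound on the moment generating function. -/
theorem integral_exp_mul_le_bernstein {Ω : Type*} [MeasurableSpace Ω] {P : Measure Ω}
    [IsProbabilityMeasure P] {D : Ω → ℝ} (hD : Measurable D) {b : ℝ} (hDb : ∀ᵐ ω ∂P, |D ω| ≤ b)
    (hD0 : ∫ ω, D ω ∂P = 0) {t : ℝ} (ht : 0 ≤ t) (htb : t * b < 3) :
    ∫ ω, Real.exp (t * D ω) ∂P ≤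
      Real.exp (t ^ 2 * (∫ ω, D ω ^ 2 ∂P) / (2 * (1 - t * b / 3))) := by
  have i1 : Integrable D P := Integrable.of_bound hD.aestronglyMeasurable b hDb
  have i2 : Integrable (fun ω => D ω ^ 2) P :=
    Integrable.of_bound (by fun_prop) (b ^ 2) (hDb.mono fun ω h => by
      rw [norm_pow]; gcongr; exact h)
  have i3 : Integrable (fun ω => Real.exp (t * D ω)) P :=
    Integrable.of_bound (by fun_prop) (Real.exp (t * b)) (hDb.mono fun ω h => by
      rw [Real.norm_eq_abs, Real.abs_exp, Real.exp_le_exp]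
      exact mul_le_mul_of_nonneg_left ((le_abs_self _).trans h) ht)
  have i4 : Integrable (fun ω => 1 + t * D ω) P := (integrable_const _).add (i1.const_mul t)
  have i5 := i2.const_mul (t ^ 2 / (2 * (1 - t * b / 3)))
  calc ∫ ω, Real.exp (t * D ω) ∂P
      ≤ ∫ ω, (1 + t * D ω + t ^ 2 / (2 * (1 - t * b / 3)) * D ω ^ 2) ∂P := by
        refine integral_mono_ae i3 (i4.add i5) (hDb.mono fun ω h => ?_)
        have := exp_le_one_add_add_sq (x := t * D ω) (c := t * b)
          (by rw [abs_mul, abs_of_nonneg ht]; gcongr) htb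
        exact this.trans_eq (by ring)
    _ = 1 + t ^ 2 * (∫ ω, D ω ^ 2 ∂P) / (2 * (1 - t * b / 3)) := by
        rw [integral_add i4 i5, integral_add (integrable_const _) (i1.const_mul t),
          integral_const_mul, integral_const_mul, hD0]
        simp
        ring
    _ ≤ _ := by
        rw [add_comm]
        exact Real.add_one_le_exp _

/-- The exponent in Bernstein's inequality for `M` variables of variance `s` bounded by `b`, chosen
uniformly over the family. The restriction `t b κ ≤ 1` keeps the total price of the dependence under
control; a larger `κ` gives a weaker tail bound and a smaller `t`. -/
theorem exists_bernstein_exponent {Ω ι : Type*} [MeasurableSpace Ω] {P : Measure Ω}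
    [IsProbabilityMeasure P] {D : ι → Ω → ℝ} (hD : ∀ i, Measurable (D i)) {b s : ℝ} (hb : 0 < b)
    (hDb : ∀ i, ∀ᵐ ω ∂P, |D i ω| ≤ b) (hD0 : ∀ i, ∫ ω, D i ω ∂P = 0)
    (hDs : ∀ i, ∫ ω, D i ω ^ 2 ∂P = s) (hs : 0 ≤ s)
    {M L κ : ℝ} (hM : 0 ≤ M) (hL : 0 < L) (hκ : 1 / 3 ≤ κ) :
    ∃ t ψ : ℝ, 0 < t ∧ t * b * κ ≤ 1 ∧ (∀ i, ∫ ω, Real.exp (t * D i ω) ∂P ≤ Real.exp ψ) ∧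
      (∀ i, ∫ ω, Real.exp (-(t * D i ω)) ∂P ≤ Real.exp ψ) ∧
      L ≤ t * (Real.sqrt (2 * M * s * L) + κ * b * L) - M * ψ := by
  have hκ0 : 0 < κ := by linarith
  have key : ∀ t i, 0 ≤ t → t * b < 3 →
      ∫ ω, Real.exp (t * D i ω) ∂P ≤ Real.exp (t ^ 2 * s / (2 * (1 - t * b / 3))) ∧
      ∫ ω, Real.exp (-(t * D i ω)) ∂P ≤ Real.exp (t ^ 2 * s / (2 * (1 - t * b / 3))) := by
    intro t i ht htb
    constructor
    · rw [← hDs i]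
      exact integral_exp_mul_le_bernstein (hD i) (hDb i) (hD0 i) ht htb
    · rw [← hDs i]
      simpa using integral_exp_mul_le_bernstein (D := fun ω => -D i ω) (hD i).neg
        (by simpa using hDb i) (by rw [integral_neg, hD0 i, neg_zero]) ht htb
  rcases (mul_nonneg hM hs).eq_or_lt with h0 | h0
  -- In the degenerate case `M s = 0` the optimal exponent is the largest admissible one. It may be
  -- `3 / b`, where `key` does not apply, so `ψ` is found directly.
  · refine ⟨1 / (b * κ), if s = 0 then 0 else 1 / κ, by positivity, le_of_eq (by field_simp),
      ?_⟩
    have hlast : ∀ ψ, M * ψ = 0 → L ≤ 1 / (b * κ) * (Real.sqrt (2 * M * s * L) + κ * b * L)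
        - M * ψ := by
      intro ψ hψ
      rw [hψ, mul_assoc 2, ← h0]
      refine le_of_eq ?_
      simp; field_simp
    by_cases hs0 : s = 0
    · rw [if_pos hs0]
      have hz : ∀ i, ∀ᵐ ω ∂P, D i ω = 0 := fun i => by
        have hi : Integrable (fun ω => D i ω ^ 2) P :=
          Integrable.of_bound ((hD i).pow_const 2).aestronglyMeasurable (b ^ 2)
            ((hDb i).mono fun ω h => by rw [norm_pow]; gcongr; exact h)
        have := (integral_eq_zero_iff_of_nonneg (fun ω => sq_nonneg (D i ω)) hi).1
          ((hDs i).trans hs0)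
        exact this.mono fun ω h => by simpa using h
      refine ⟨fun i => ?_, fun i => ?_, hlast 0 (mul_zero _)⟩
      · rw [integral_congr_ae ((hz i).mono fun ω h => by
          show _ = (1 : ℝ); rw [h]; simp)]; simp
      · rw [integral_congr_ae ((hz i).mono fun ω h => by
          show _ = (1 : ℝ); rw [h]; simp)]; simp
    · rw [if_neg hs0]
      have hM0 : M = 0 := by
        rcases mul_eq_zero.1 h0.symm with h | h
        · exact h
        · exact absurd h hs0
      have hle : ∀ i, ∀ᵐ ω ∂P, |1 / (b * κ) * D i ω| ≤ 1 / κ := fun i => (hDb i).mono fun ω h => by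
        rw [abs_mul, abs_of_pos (by positivity), show 1 / κ = 1 / (b * κ) * b by field_simp]
        gcongr
      have hfin : ∀ f : Ω → ℝ, (∀ᵐ ω ∂P, |f ω| ≤ 1 / κ) →
          ∫ ω, Real.exp (f ω) ∂P ≤ Real.exp (1 / κ) := fun f hf => by
        have := norm_integral_le_of_norm_le_const (μ := P) (f := fun ω => Real.exp (f ω))
          (C := Real.exp (1 / κ)) (hf.mono fun ω h => by
            rw [Real.norm_eq_abs, Real.abs_exp, Real.exp_le_exp]; exact (le_abs_self _).trans h)
        simpa using (le_abs_self _).trans this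
      exact ⟨fun i => hfin _ (hle i), fun i => hfin _ (by simpa only [abs_neg] using hle i),
        hlast _ (by rw [hM0, zero_mul])⟩
  -- Otherwise `t = u / (1 + κ b u)` with `u = √(2 L / (M s))`.
  · have hV : 0 < M * s := h0
    obtain ⟨u, hu, hu2⟩ : ∃ u : ℝ, 0 < u ∧ u ^ 2 * (M * s) = 2 * L :=
      ⟨Real.sqrt (2 * L / (M * s)), by positivity, by
        rw [Real.sq_sqrt (by positivity)]; exact div_mul_cancel₀ _ hV.ne'⟩
    have hsqrt : Real.sqrt (2 * M * s * L) = u * (M * s) := by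
      rw [show 2 * M * s * L = (u * (M * s)) ^ 2 by
        rw [mul_pow, show (M * s) ^ 2 = (M * s) * (M * s) by ring, ← mul_assoc, hu2]; ring]
      exact Real.sqrt_sq (by positivity)
    set t := u / (1 + κ * b * u) with ht
    have hden : 0 < 1 + κ * b * u := by positivity
    have htb : t * b * κ < 1 := by
      rw [ht, div_mul_eq_mul_div, div_mul_eq_mul_div, div_lt_one hden]; nlinarith
    have ht0 : 0 < t := by positivity
    have htb3 : t * b < 3 := by
      have : 0 < t * b := by positivity
      nlinarith
    refine ⟨t, t ^ 2 * s / (2 * (1 - t * b / 3)), ht0, htb.le,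
      fun i => (key t i ht0.le htb3).1, fun i => (key t i ht0.le htb3).2, ?_⟩
    have h1 : 1 - t * b * κ = 1 / (1 + κ * b * u) := by rw [ht]; field_simp; ring
    have h2 : 1 - t * b * κ ≤ 1 - t * b / 3 := by
      have : 0 < t * b := by positivity
      nlinarith
    have h3 : M * (t ^ 2 * s / (2 * (1 - t * b / 3))) ≤ t ^ 2 * (M * s) / (2 * (1 - t * b * κ)) := by
      rw [← mul_div_assoc, show M * (t ^ 2 * s) = t ^ 2 * (M * s) by ring]
      have : 0 < 1 - t * b * κ := by linarith
      gcongr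
    have h4 : t ^ 2 * (M * s) / (2 * (1 - t * b * κ)) = L / (1 + κ * b * u) := by
      rw [h1, ht, div_pow, div_mul_eq_mul_div, hu2]; field_simp
    have h5 : t * (u * (M * s) + κ * b * L) = (2 * L + κ * b * u * L) / (1 + κ * b * u) := by
      rw [← hu2, ht]; field_simp
    rw [hsqrt, h5]
    have : (2 * L + κ * b * u * L) / (1 + κ * b * u) - L / (1 + κ * b * u) = L := by
      field_simp; ring
    linarith

/-! ### Mixing and stationary processes -/

theorem pastSigma_le {Ω E : Type*} [mΩ : MeasurableSpace Ω] [MeasurableSpace E] {U : ℕ → Ω → E}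
    (hU : ∀ j, Measurable (U j)) (t : ℕ) : pastSigma U t ≤ mΩ :=
  iSup₂_le fun i _ => (hU i).comap_le

theorem futureSigma_le {Ω E : Type*} [mΩ : MeasurableSpace Ω] [MeasurableSpace E] {U : ℕ → Ω → E}
    (hU : ∀ j, Measurable (U j)) (t : ℕ) : futureSigma U t ≤ mΩ :=
  iSup₂_le fun i _ => (hU i).comap_le

theorem pastSigma_mono {Ω E : Type*} [MeasurableSpace E] (U : ℕ → Ω → E) :
    Monotone (pastSigma U) := fun _ _ h =>
  iSup₂_le fun i hi => le_iSup₂_of_le i (hi.trans h) le_rfl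

theorem futureSigma_anti {Ω E : Type*} [MeasurableSpace E] (U : ℕ → Ω → E) :
    Antitone (futureSigma U) := fun _ _ h =>
  iSup₂_le fun i hi => le_iSup₂_of_le i (h.trans hi) le_rfl

theorem measurable_pastSigma {Ω E : Type*} [MeasurableSpace E] (U : ℕ → Ω → E) {i t : ℕ}
    (h : i ≤ t) : Measurable[pastSigma U t] (U i) :=
  (comap_measurable (U i)).mono (le_iSup₂_of_le i h le_rfl) le_rfl

theorem measurable_futureSigma {Ω E : Type*} [MeasurableSpace E] (U : ℕ → Ω → E) {i t : ℕ}
    (h : t ≤ i) : Measurable[futureSigma U t] (U i) :=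
  (comap_measurable (U i)).mono (le_iSup₂_of_le i h le_rfl) le_rfl

theorem alphaClose_bot {Ω : Type*} {𝓖 mΩ : MeasurableSpace Ω} (P : Measure Ω)
    [IsProbabilityMeasure P] {a : ℝ} (ha : 0 ≤ a) : AlphaClose P ⊥ 𝓖 a := by
  intro A A' hA _
  rcases MeasurableSpace.measurableSet_bot_iff.1 hA with rfl | rfl <;> simpa

theorem alphaClose_pastSigma_futureSigma {Ω E : Type*} [MeasurableSpace Ω] [MeasurableSpace E]
    (P : Measure Ω) [IsProbabilityMeasure P] (U : ℕ → Ω → E) {τ t s : ℕ} (h : t + τ ≤ s) :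
    AlphaClose P (pastSigma U t) (futureSigma U s) (alphaCoeff P U τ) := by
  intro A A' hA hA'
  refine le_csSup ⟨1, ?_⟩ ⟨t, A, A', hA, futureSigma_anti U h _ hA', rfl⟩
  rintro x ⟨t, A, A', -, -, rfl⟩
  have h1 : P.real A * P.real A' ≤ 1 :=
    mul_le_one₀ measureReal_le_one measureReal_nonneg measureReal_le_one
  have h2 : 0 ≤ P.real A * P.real A' := mul_nonneg measureReal_nonneg measureReal_nonneg
  rw [abs_le]
  constructor <;> linarith [measureReal_nonneg (μ := P) (s := A ∩ A'),
    measureReal_le_one (μ := P) (s := A ∩ A')]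

theorem IsExpAlphaMixing.mixingTime_spec {Ω E : Type*} [MeasurableSpace Ω] [MeasurableSpace E]
    {P : Measure Ω} {U : ℕ → Ω → E} {μ ρ : ℝ} (h : IsExpAlphaMixing P U μ ρ) {η : ℝ}
    (hη : 0 < η) : 1 ≤ mixingTime P U η ∧ alphaCoeff P U (mixingTime P U η) ≤ η := by
  refine Nat.sInf_mem (s := {τ : ℕ | 1 ≤ τ ∧ alphaCoeff P U τ ≤ η}) ?_
  obtain ⟨k, hk⟩ := exists_pow_lt_of_lt_one (div_pos hη h.mu_pos) h.rho_lt_one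
  refine ⟨k + 1, by omega, (h.bound _ (by omega)).trans ?_⟩
  have h1 : ρ ^ (k + 1) ≤ ρ ^ k := pow_le_pow_of_le_one h.rho_pos.le h.rho_lt_one.le (by omega)
  calc μ * ρ ^ (k + 1) ≤ μ * (η / μ) := by
        have := h.mu_pos
        gcongr
        exact h1.trans hk.le
    _ = η := mul_div_cancel₀ _ h.mu_pos.ne'

theorem IsStationaryProcess.identDistrib_shift {Ω E : Type*} [MeasurableSpace Ω]
    [MeasurableSpace E] {P : Measure Ω} {U : ℕ → Ω → E} (h : IsStationaryProcess P U)
    (hU : ∀ j, Measurable (U j)) (k : ℕ) :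
    IdentDistrib (fun ω (i : ℕ) => U (k + i) ω) (fun ω (i : ℕ) => U i ω) P P := by
  induction k with
  | zero => simpa using IdentDistrib.refl (measurable_pi_lambda _ hU).aemeasurable
  | succ k ih =>
    have h1 : IdentDistrib (fun ω (i : ℕ) => U (i + 1) ω) (fun ω (i : ℕ) => U i ω) P P :=
      ⟨(measurable_pi_lambda _ fun i => hU (i + 1)).aemeasurable,
        (measurable_pi_lambda _ hU).aemeasurable, h⟩
    have h2 := h1.comp (u := fun (x : ℕ → E) (i : ℕ) => x (k + i)) (by fun_prop)
    have := h2.trans ih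
    simpa [Function.comp_def, Nat.add_assoc, Nat.add_comm 1] using this

/-! ### Block sums of a bounded stationary process -/

/-- The centred sum of the `i`-th block of length `τ`, i.e. of `U (iτ), …, U (iτ + τ - 1)`. -/
noncomputable def blockDev {Ω : Type*} [MeasurableSpace Ω] (P : Measure Ω) (U : ℕ → Ω → ℝ)
    (τ i : ℕ) (ω : Ω) : ℝ :=
  ∑ j ∈ Finset.range τ, U (i * τ + j) ω - τ * ∫ ω', U 0 ω' ∂P

section Blocks

variable {Ω : Type*} [MeasurableSpace Ω] {P : Measure Ω} {U : ℕ → Ω → ℝ} {B : ℝ}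

theorem measurable_blockDev (hU : ∀ j, Measurable (U j)) (τ i : ℕ) :
    Measurable (blockDev P U τ i) :=
  (Finset.measurable_fun_sum _ fun _ _ => hU _).sub_const _

theorem sum_mem_Icc_ae (hB : ∀ j, ∀ᵐ ω ∂P, U j ω ∈ Set.Icc 0 B) (k m : ℕ) :
    ∀ᵐ ω ∂P, ∑ j ∈ Finset.range m, U (k + j) ω ∈ Set.Icc 0 (m * B) := by
  filter_upwards [ae_all_iff.2 hB] with ω hω
  refine ⟨Finset.sum_nonneg fun j _ => (hω _).1, ?_⟩
  simpa using Finset.sum_le_card_nsmul (Finset.range m) (fun j => U (k + j) ω) B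
    fun j _ => (hω _).2

theorem identDistrib_sum (hU : ∀ j, Measurable (U j)) (hstat : IsStationaryProcess P U)
    (k m : ℕ) : IdentDistrib (fun ω => ∑ j ∈ Finset.range m, U (k + j) ω)
      (fun ω => ∑ j ∈ Finset.range m, U j ω) P P :=
  (hstat.identDistrib_shift hU k).comp (u := fun x : ℕ → ℝ => ∑ j ∈ Finset.range m, x j)
    (by fun_prop)

theorem blockVariance_nonneg (τ : ℕ) : 0 ≤ blockVariance P U τ :=
  mul_nonneg (by positivity) (variance_nonneg _ _)

theorem blockDev_mem_Icc_ae (hB : ∀ j, ∀ᵐ ω ∂P, U j ω ∈ Set.Icc 0 B) (τ i : ℕ) :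
    ∀ᵐ ω ∂P, blockDev P U τ i ω ∈
      Set.Icc (-(τ * ∫ ω', U 0 ω' ∂P)) (-(τ * ∫ ω', U 0 ω' ∂P) + τ * B) :=
  (sum_mem_Icc_ae hB (i * τ) τ).mono fun ω h =>
    ⟨by rw [blockDev]; linarith [h.1], by rw [blockDev]; linarith [h.2]⟩

variable [IsProbabilityMeasure P]

theorem integral_mem_Icc (hU : ∀ j, Measurable (U j))
    (hB : ∀ j, ∀ᵐ ω ∂P, U j ω ∈ Set.Icc 0 B) : ∫ ω, U 0 ω ∂P ∈ Set.Icc 0 B := by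
  have hi : Integrable (U 0) P := Integrable.of_mem_Icc 0 B (hU 0).aemeasurable (hB 0)
  refine ⟨integral_nonneg_of_ae ((hB 0).mono fun ω h => h.1), ?_⟩
  simpa using integral_mono_ae hi (integrable_const B) ((hB 0).mono fun ω h => h.2)

theorem abs_blockDev_le_ae (hU : ∀ j, Measurable (U j))
    (hB : ∀ j, ∀ᵐ ω ∂P, U j ω ∈ Set.Icc 0 B) (τ i : ℕ) :
    ∀ᵐ ω ∂P, |blockDev P U τ i ω| ≤ τ * B := by
  obtain ⟨h0, h1⟩ := integral_mem_Icc hU hB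
  refine (blockDev_mem_Icc_ae hB τ i).mono fun ω h => abs_le.2 ⟨?_, ?_⟩
  · exact le_trans (neg_le_neg (by gcongr)) h.1
  · exact h.2.trans (by linarith [mul_nonneg (Nat.cast_nonneg (α := ℝ) τ) h0])

theorem integral_sum_eq (hU : ∀ j, Measurable (U j)) (hstat : IsStationaryProcess P U)
    (hB : ∀ j, ∀ᵐ ω ∂P, U j ω ∈ Set.Icc 0 B) (m : ℕ) :
    ∫ ω, ∑ j ∈ Finset.range m, U j ω ∂P = m * ∫ ω, U 0 ω ∂P := by
  rw [integral_finsetSum _ fun j _ => Integrable.of_mem_Icc 0 B (hU j).aemeasurable (hB j)]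
  have : ∀ j, ∫ ω, U j ω ∂P = ∫ ω, U 0 ω ∂P := fun j => by
    simpa using (identDistrib_sum hU hstat j 1).integral_eq
  simp [this]

theorem integral_blockDev (hU : ∀ j, Measurable (U j)) (hstat : IsStationaryProcess P U)
    (hB : ∀ j, ∀ᵐ ω ∂P, U j ω ∈ Set.Icc 0 B) (τ i : ℕ) :
    ∫ ω, blockDev P U τ i ω ∂P = 0 := by
  simp only [blockDev]
  rw [integral_sub _ (integrable_const _), (identDistrib_sum hU hstat (i * τ) τ).integral_eq,
    integral_sum_eq hU hstat hB]
  · simp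
  · exact integrable_finsetSum _ fun j _ =>
      Integrable.of_mem_Icc 0 B (hU _).aemeasurable (hB _)

theorem integral_blockDev_sq (hU : ∀ j, Measurable (U j)) (hstat : IsStationaryProcess P U)
    (hB : ∀ j, ∀ᵐ ω ∂P, U j ω ∈ Set.Icc 0 B) {τ : ℕ} (hτ : 1 ≤ τ) (i : ℕ) :
    ∫ ω, blockDev P U τ i ω ^ 2 ∂P = τ ^ 2 * blockVariance P U τ := by
  have hid := identDistrib_sum hU hstat (i * τ) τ
  have hτ' : (τ : ℝ) ≠ 0 := by positivity
  rw [blockVariance, ← mul_assoc, mul_one_div_cancel (by positivity), one_mul,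
    ← hid.variance_eq, variance_eq_integral hid.aemeasurable_fst, hid.integral_eq,
    integral_sum_eq hU hstat hB]
  rfl

theorem blockVariance_le (hU : ∀ j, Measurable (U j)) (hstat : IsStationaryProcess P U)
    (hB : ∀ j, ∀ᵐ ω ∂P, U j ω ∈ Set.Icc 0 B) {τ : ℕ} (hτ : 1 ≤ τ) :
    blockVariance P U τ ≤ B * ∫ ω, U 0 ω ∂P := by
  have hm : Measurable fun ω => ∑ j ∈ Finset.range τ, U j ω :=
    Finset.measurable_fun_sum _ fun j _ => hU j
  have hb : ∀ᵐ ω ∂P, ∑ j ∈ Finset.range τ, U j ω ∈ Set.Icc 0 (τ * B) := by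
    simpa using sum_mem_Icc_ae hB 0 τ
  have hi : Integrable (fun ω => ∑ j ∈ Finset.range τ, U j ω) P :=
    Integrable.of_mem_Icc 0 (τ * B) hm.aemeasurable hb
  have h1 : variance (fun ω => ∑ j ∈ Finset.range τ, U j ω) P ≤
      τ ^ 2 * (B * ∫ ω, U 0 ω ∂P) := by
    refine (variance_le_expectation_sq hm.aestronglyMeasurable).trans ?_
    calc _ ≤ ∫ ω, τ * B * ∑ j ∈ Finset.range τ, U j ω ∂P := by
          refine integral_mono_of_nonneg (.of_forall fun ω => sq_nonneg _) (hi.const_mul _)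
            (hb.mono fun ω h => ?_)
          simp only [Pi.pow_apply]
          rw [sq]
          exact mul_le_mul_of_nonneg_right h.2 h.1
      _ = _ := by rw [integral_const_mul, integral_sum_eq hU hstat hB]; ring
  have hτ' : (0 : ℝ) < τ := by positivity
  rw [blockVariance, one_div_mul_eq_div, div_le_iff₀ (by positivity)]
  linarith

/-- The expected potential of the sum of every `d`-th block, starting with block `o`. The condition on
`d` says that the last index of a block and the first index of the next selected block are at least
`τ` apart: `d = 2` always works, and `d = 1` works for `τ = 1`. Both tails are covered, through the
sign of `θ`. -/
theorem integral_sigmoid_blockDev_le (hU : ∀ j, Measurable (U j))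
    (hB : ∀ j, ∀ᵐ ω ∂P, U j ω ∈ Set.Icc 0 B) {τ d : ℕ} (hd : 2 * τ ≤ d * τ + 1)
    (hτ : 1 ≤ τ) {a : ℝ} (ha : 0 ≤ a)
    (hα : ∀ t s, t + τ ≤ s → AlphaClose P (pastSigma U t) (futureSigma U s) a)
    {θ ψ : ℝ} (hψ : ∀ i, ∫ ω, Real.exp (θ * blockDev P U τ i ω) ∂P ≤ Real.exp ψ)
    (c : ℝ) (o m : ℕ) :
    ∫ ω, Real.sigmoid (c + (∑ i ∈ Finset.range m, θ * blockDev P U τ (d * i + o) ω - m * ψ)) ∂P ≤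
      Real.exp c + m * (a * (|θ| * (τ * B)) / 4) := by
  have hB0 : 0 ≤ B := (integral_mem_Icc hU hB).1.trans (integral_mem_Icc hU hB).2
  set e := ∫ ω', U 0 ω' ∂P with he
  -- There is no earlier block before the first one, so its past is the trivial σ-algebra.
  let 𝓕 : ℕ → MeasurableSpace Ω
    | 0 => ⊥
    | i + 1 => pastSigma U ((d * i + o) * τ + (τ - 1))
  refine integral_sigmoid_sum_le (l := if 0 ≤ θ then θ * -(τ * e) else θ * (-(τ * e) + τ * B))
    (by positivity) 𝓕
    (fun i => futureSigma U ((d * i + o) * τ)) ?_ (fun i => futureSigma_le hU _) ?_ ?_ ?_ ?_ ?_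
    (fun i => hψ _) m
  · rintro (_ | i)
    · exact bot_le
    · exact pastSigma_le hU _
  · refine monotone_nat_of_le_succ ?_
    rintro (_ | i)
    · exact bot_le
    · refine pastSigma_mono U ?_
      gcongr
      omega
  · rintro (_ | i)
    · exact alphaClose_bot P ha
    · refine hα _ _ ?_
      have : (d * (i + 1) + o) * τ = (d * i + o) * τ + d * τ := by ring
      omega
  · intro i
    refine Measurable.const_mul (Measurable.sub_const (Finset.measurable_fun_sum _ fun j hj => ?_) _) _
    exact measurable_pastSigma U (by have := Finset.mem_range.1 hj; omega)
  · intro i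
    refine Measurable.const_mul (Measurable.sub_const (Finset.measurable_fun_sum _ fun j hj => ?_) _) _
    exact measurable_futureSigma U (by omega)
  · intro i
    refine (blockDev_mem_Icc_ae hB τ (d * i + o)).mono fun ω h => ?_
    split_ifs with hθ
    · rw [abs_of_nonneg hθ]
      constructor
      · exact mul_le_mul_of_nonneg_left h.1 hθ
      · rw [← mul_add]; exact mul_le_mul_of_nonneg_left h.2 hθ
    · rw [abs_of_neg (not_le.1 hθ)]
      constructor
      · exact mul_le_mul_of_nonpos_left h.2 (not_le.1 hθ).le
      · have := mul_le_mul_of_nonpos_left h.1 (not_le.1 hθ).le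
        rw [← he] at this
        linarith

/-! ### Tail bounds for the sum of the blocks -/

theorem measureReal_le_integral_of_ae {Ω : Type*} [MeasurableSpace Ω] {P : Measure Ω}
    [IsFiniteMeasure P] {F : Ω → ℝ} (hF : Integrable F P) (hF0 : ∀ ω, 0 ≤ F ω) {E : Set Ω}
    (hE : ∀ᵐ ω ∂P, ω ∈ E → 1 ≤ F ω) : P.real E ≤ ∫ ω, F ω ∂P := by
  have h1 := mul_meas_ge_le_integral_of_nonneg (μ := P) (.of_forall hF0) hF 1
  rw [one_mul] at h1
  exact (ENNReal.toReal_mono (measure_ne_top _ _) (measure_mono_ae hE)).trans h1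

theorem sum_range_eq_add_even_odd {M : Type*} [AddCommMonoid M] (f : ℕ → M) (q : ℕ) :
    ∑ i ∈ Finset.range q, f i = ∑ i ∈ Finset.range ((q + 1) / 2), f (2 * i) +
      ∑ i ∈ Finset.range (q / 2), f (2 * i + 1) := by
  induction q with
  | zero => simp
  | succ q ih =>
    rw [Finset.sum_range_succ, ih]
    obtain ⟨m, rfl | rfl⟩ := Nat.even_or_odd' q
    · rw [show (2 * m + 1) / 2 = m by omega, show 2 * m / 2 = m by omega,
        show (2 * m + 1 + 1) / 2 = m + 1 by omega, Finset.sum_range_succ]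
      abel
    · rw [show (2 * m + 1 + 1) / 2 = m + 1 by omega, show (2 * m + 1) / 2 = m by omega,
        show (2 * m + 1 + 1 + 1) / 2 = m + 1 by omega, Finset.sum_range_succ _ m,
        Finset.sum_range_succ _ m]
      abel

theorem three_halves_le_log_five : 3 / 2 ≤ Real.log 5 := by
  rw [Real.le_log_iff_exp_le (by norm_num)]
  have h1 : Real.exp (3 / 2) ^ 2 = Real.exp 1 ^ 3 := by
    rw [← Real.exp_nat_mul, ← Real.exp_nat_mul]; norm_num
  have h2 : Real.exp 1 ^ 3 ≤ 2.72 ^ 3 := by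
    have := Real.exp_one_lt_d9
    gcongr
    linarith
  nlinarith [Real.exp_pos (3 / 2)]

/-- The tail of the block sums for `τ = 1`, where no separation into classes is needed. -/
theorem measureReal_abs_sum_blockDev_one_le (hU : ∀ j, Measurable (U j))
    (hstat : IsStationaryProcess P U) (hB : ∀ j, ∀ᵐ ω ∂P, U j ω ∈ Set.Icc 0 B) (hB0 : 0 < B)
    {a : ℝ} (ha : 0 ≤ a)
    (hα : ∀ t s, t + 1 ≤ s → AlphaClose P (pastSigma U t) (futureSigma U s) a)
    {δ : ℝ} (hδ : 0 < δ) (hδ1 : δ < 1) (q : ℕ) :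
    P.real {ω | Real.sqrt (4 * q * blockVariance P U 1 * Real.log (1 / δ)) +
        4 / 3 * B * Real.log (1 / δ) < |∑ i ∈ Finset.range q, blockDev P U 1 i ω|} ≤
      4 * δ + q * a := by
  set L := Real.log (1 / δ) with hL
  have hL0 : 0 < L := Real.log_pos (by rw [lt_div_iff₀ hδ]; linarith)
  have hδL : Real.log δ = -L := by rw [hL, one_div, Real.log_inv, neg_neg]
  set s := blockVariance P U 1 with hs
  have hs0 : 0 ≤ s := blockVariance_nonneg 1
  obtain ⟨t, ψ, ht, htb, hp, hn, hLt⟩ := exists_bernstein_exponent (P := P)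
    (D := blockDev P U 1) (s := s) (measurable_blockDev hU 1) hB0
    (fun i => by simpa using abs_blockDev_le_ae hU hB 1 i) (integral_blockDev hU hstat hB 1)
    (fun i => by simpa using integral_blockDev_sq hU hstat hB le_rfl i) hs0
    (Nat.cast_nonneg (α := ℝ) q) hL0 (κ := 1) (by norm_num)
  have h1 := integral_sigmoid_blockDev_le hU hB (d := 1) (by norm_num) le_rfl ha hα hp (-L) 0 q
  have h2 := integral_sigmoid_blockDev_le hU hB (d := 1) (θ := -t) (by norm_num) le_rfl ha hα
    (by simpa using hn) (-L) 0 q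
  rw [abs_neg] at h2
  rw [abs_of_pos ht, ← hδL, Real.exp_log hδ] at h1 h2
  simp only [one_mul, add_zero, Nat.cast_one, ← Finset.mul_sum] at h1 h2
  have hm : Measurable fun ω => ∑ i ∈ Finset.range q, blockDev P U 1 i ω :=
    Finset.measurable_fun_sum _ fun i _ => measurable_blockDev hU 1 i
  set W : Ω → ℝ := fun ω => ∑ i ∈ Finset.range q, blockDev P U 1 i ω with hW
  have i1 : Integrable (fun ω => Real.sigmoid (Real.log δ + (t * W ω - q * ψ))) P :=
    integrable_sigmoid (by fun_prop)
  have i2 : Integrable (fun ω => Real.sigmoid (Real.log δ + (-t * W ω - q * ψ))) P :=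
    integrable_sigmoid (by fun_prop)
  refine (measureReal_le_integral_of_ae ((i1.add i2).const_mul 2) (fun ω => ?_)
    (.of_forall fun ω hω => ?_)).trans ?_
  · simp only [Pi.add_apply]
    linarith [Real.sigmoid_nonneg (Real.log δ + (t * W ω - q * ψ)),
      Real.sigmoid_nonneg (Real.log δ + (-t * W ω - q * ψ))]
  · simp only [Pi.add_apply]
    have hω' : Real.sqrt (4 * q * s * L) + 4 / 3 * B * L < |W ω| := hω
    have h3 : Real.sqrt (2 * q * s * L) + 1 * B * L ≤ |W ω| := by
      have : Real.sqrt (2 * q * s * L) ≤ Real.sqrt (4 * q * s * L) := by gcongr; norm_num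
      have : 0 ≤ B * L := by positivity
      linarith
    have h4 := mul_le_mul_of_nonneg_left h3 ht.le
    rcases abs_cases (W ω) with ⟨hc, -⟩ | ⟨hc, -⟩ <;> rw [hc] at h4
    · linarith [one_half_le_sigmoid (x := Real.log δ + (t * W ω - q * ψ)) (by linarith),
        Real.sigmoid_nonneg (Real.log δ + (-t * W ω - q * ψ))]
    · linarith [one_half_le_sigmoid (x := Real.log δ + (-t * W ω - q * ψ)) (by linarith),
        Real.sigmoid_nonneg (Real.log δ + (t * W ω - q * ψ))]
  · simp only [Pi.add_apply]
    rw [integral_const_mul, integral_add i1 i2]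
    have : (q : ℝ) * a * (t * B) ≤ q * a * 1 :=
      mul_le_mul_of_nonneg_left (by linarith) (by positivity)
    linarith

/-- The tail of the block sums for `τ ≥ 2`, by the potentials of the even and of the odd blocks. The
threshold lies `τ B` below the one required of the whole sum, to leave room for the incomplete last
block. -/
theorem measureReal_abs_sum_blockDev_le (hU : ∀ j, Measurable (U j))
    (hstat : IsStationaryProcess P U) (hB : ∀ j, ∀ᵐ ω ∂P, U j ω ∈ Set.Icc 0 B) (hB0 : 0 < B)
    {τ : ℕ} (hτ : 2 ≤ τ) {a : ℝ} (ha : 0 ≤ a)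
    (hα : ∀ t s, t + τ ≤ s → AlphaClose P (pastSigma U t) (futureSigma U s) a)
    {δ : ℝ} (hδ : 0 < δ) (hδ1 : 4 * δ < 1) (q : ℕ) :
    P.real {ω | Real.sqrt (4 * q * (τ ^ 2 * blockVariance P U τ) * Real.log (1 / δ)) +
        (4 / 3 * Real.log (1 / δ) - 1) * (τ * B) < |∑ i ∈ Finset.range q, blockDev P U τ i ω|} ≤
      4 * δ + 2 * q * a := by
  set L := Real.log (1 / δ) with hL
  -- The four potentials start at `3 δ / 4` and carry the weight `4 / 3`. A pair of them reaches
  -- `3 / 4` once its arguments sum to `2 log (3 / 5)`, so the exponent to be gained per class is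
  -- `K = log (3 / 5) - log (3 δ / 4)`. It is smaller than `L`, which pays for the term `-1` in the
  -- threshold: `2 K / 3 ≤ 4 L / 3 - 1` because `L ≥ log 4` and `log 5 ≥ 3 / 2`.
  set K := L - Real.log (5 / 4) with hK
  have hL4 : Real.log 4 ≤ L := Real.log_le_log (by norm_num) (by rw [le_div_iff₀ hδ]; linarith)
  have hl5 : Real.log 5 = Real.log 4 + Real.log (5 / 4) := by
    rw [← Real.log_mul (by norm_num) (by norm_num)]; norm_num
  have hl54 : 0 < Real.log (5 / 4) := Real.log_pos (by norm_num)
  have hl54' : Real.log (5 / 4) < Real.log 4 := Real.log_lt_log (by norm_num) (by norm_num)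
  have hl := three_halves_le_log_five
  have hK0 : 0 < K := by linarith
  have hτ0 : (0 : ℝ) < τ := by positivity
  set b := τ * B with hb
  have hb0 : 0 < b := by positivity
  set s := τ ^ 2 * blockVariance P U τ with hs
  have hs0 : 0 ≤ s := mul_nonneg (by positivity) (blockVariance_nonneg τ)
  set c := Real.log (3 / 4 * δ) with hc
  have hcK : c + K = Real.log (3 / 5) := by
    rw [hc, hK, hL, Real.log_mul (by norm_num) hδ.ne', one_div, Real.log_inv,
      show (3 / 4 : ℝ) = 3 / 5 * (5 / 4) by norm_num, Real.log_mul (by norm_num) (by norm_num)]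
    ring
  have hec : Real.exp c = 3 / 4 * δ := Real.exp_log (by positivity)
  -- Both classes use the same `t` and `ψ`, fitted to the average class size `q / 2`.
  obtain ⟨t, ψ, ht, htb, hp, hn, hLt⟩ := exists_bernstein_exponent (P := P)
    (D := blockDev P U τ) (s := s) (M := q / 2) (measurable_blockDev hU τ) hb0
    (abs_blockDev_le_ae hU hB τ) (integral_blockDev hU hstat hB τ)
    (integral_blockDev_sq hU hstat hB (by omega)) hs0 (by positivity) hK0 (κ := 1 / 3) le_rfl
  have hn' : ∀ i, ∫ ω, Real.exp (-t * blockDev P U τ i ω) ∂P ≤ Real.exp ψ := by simpa using hn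
  have hτ1 : 1 ≤ τ := by omega
  have bound : ∀ θ : ℝ, |θ| = t →
      (∀ i, ∫ ω, Real.exp (θ * blockDev P U τ i ω) ∂P ≤ Real.exp ψ) → ∀ o m : ℕ,
      ∫ ω, Real.sigmoid (c + (θ * ∑ i ∈ Finset.range m, blockDev P U τ (2 * i + o) ω - m * ψ)) ∂P ≤
        3 / 4 * δ + m * (a * (t * b) / 4) := fun θ hθ h o m => by
    have := integral_sigmoid_blockDev_le hU hB (d := 2) (by omega) hτ1 ha hα h c o m
    simp only [← Finset.mul_sum] at this
    rwa [hθ, hec, ← hb] at this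
  have hmeas : ∀ o m : ℕ, Measurable fun ω =>
      ∑ i ∈ Finset.range m, blockDev P U τ (2 * i + o) ω := fun o m =>
    Finset.measurable_fun_sum _ fun i _ => measurable_blockDev hU τ _
  set m₀ := (q + 1) / 2 with hm₀
  set m₁ := q / 2 with hm₁
  have hq : (m₀ : ℝ) + m₁ = q := by exact_mod_cast (by omega : m₀ + m₁ = q)
  have b₁ := bound t (abs_of_pos ht) hp 0 m₀
  have b₂ := bound t (abs_of_pos ht) hp 1 m₁
  have b₃ := bound (-t) (by rw [abs_neg, abs_of_pos ht]) hn' 0 m₀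
  have b₄ := bound (-t) (by rw [abs_neg, abs_of_pos ht]) hn' 1 m₁
  have hX := hmeas 0 m₀
  have hY := hmeas 1 m₁
  set X : Ω → ℝ := fun ω => ∑ i ∈ Finset.range m₀, blockDev P U τ (2 * i + 0) ω with hXd
  set Y : Ω → ℝ := fun ω => ∑ i ∈ Finset.range m₁, blockDev P U τ (2 * i + 1) ω with hYd
  have hXY : ∀ ω, ∑ i ∈ Finset.range q, blockDev P U τ i ω = X ω + Y ω := fun ω =>
    sum_range_eq_add_even_odd _ q
  have hi : ∀ (Z : Ω → ℝ) (θ : ℝ) (m : ℕ), Measurable Z →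
      Integrable (fun ω => Real.sigmoid (c + (θ * Z ω - m * ψ))) P := fun Z θ m hZ =>
    integrable_sigmoid (by fun_prop)
  have i₁ := hi X t m₀ hX
  have i₂ := hi Y t m₁ hY
  have i₃ := hi X (-t) m₀ hX
  have i₄ := hi Y (-t) m₁ hY
  refine (measureReal_le_integral_of_ae (((i₁.add i₂).add (i₃.add i₄)).const_mul (4 / 3))
    (fun ω => ?_) (.of_forall fun ω hω => ?_)).trans ?_
  · simp only [Pi.add_apply]
    have := Real.sigmoid_nonneg
    have p₁ := this (c + (t * X ω - m₀ * ψ))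
    have p₂ := this (c + (t * Y ω - m₁ * ψ))
    have p₃ := this (c + (-t * X ω - m₀ * ψ))
    have p₄ := this (c + (-t * Y ω - m₁ * ψ))
    linarith
  · simp only [Pi.add_apply]
    have hω' : Real.sqrt (4 * q * s * L) + (4 / 3 * L - 1) * b < |X ω + Y ω| := by
      rw [← hXY]; exact hω
    have h3 : 2 * (Real.sqrt (2 * (q / 2) * s * K) + 1 / 3 * b * K) ≤ |X ω + Y ω| := by
      have e1 : Real.sqrt (4 * q * s * L) = 2 * Real.sqrt (q * s * L) := by
        rw [show 4 * q * s * L = 2 ^ 2 * (q * s * L) by ring, Real.sqrt_mul (by norm_num),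
          Real.sqrt_sq (by norm_num)]
      have e2 : Real.sqrt (2 * (q / 2) * s * K) ≤ Real.sqrt (q * s * L) := by
        rw [show (2 * (q / 2) * s * K : ℝ) = q * s * K by ring]
        gcongr
        linarith
      have e3 : 2 * (1 / 3 * b * K) ≤ (4 / 3 * L - 1) * b := by
        rw [show 2 * (1 / 3 * b * K) = (2 / 3 * K) * b by ring]
        gcongr
        linarith
      linarith
    have h4 := mul_le_mul_of_nonneg_left h3 ht.le
    have hqψ : (m₀ : ℝ) * ψ + m₁ * ψ = q * ψ := by rw [← hq]; ring
    have := Real.sigmoid_nonneg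
    have p₁ := this (c + (t * X ω - m₀ * ψ))
    have p₂ := this (c + (t * Y ω - m₁ * ψ))
    have p₃ := this (c + (-t * X ω - m₀ * ψ))
    have p₄ := this (c + (-t * Y ω - m₁ * ψ))
    rcases abs_cases (X ω + Y ω) with ⟨h5, -⟩ | ⟨h5, -⟩ <;> rw [h5] at h4
    · linarith [three_quarters_le_sigmoid_add_sigmoid (x := c + (t * X ω - m₀ * ψ))
        (y := c + (t * Y ω - m₁ * ψ)) (by linarith)]
    · linarith [three_quarters_le_sigmoid_add_sigmoid (x := c + (-t * X ω - m₀ * ψ))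
        (y := c + (-t * Y ω - m₁ * ψ)) (by linarith)]
  · rw [integral_const_mul, integral_add' (i₁.add i₂) (i₃.add i₄), integral_add' i₁ i₂,
      integral_add' i₃ i₄]
    have h6 : (q : ℝ) * (a * (t * b)) ≤ q * (a * 3) := by
      gcongr
      linarith
    rw [← hq] at h6 ⊢
    linarith

theorem abs_sum_sub_le_ae (hU : ∀ j, Measurable (U j))
    (hB : ∀ j, ∀ᵐ ω ∂P, U j ω ∈ Set.Icc 0 B) {τ : ℕ} (hτ : 1 ≤ τ) (n : ℕ) :
    ∀ᵐ ω ∂P, |∑ j ∈ Finset.range n, U j ω - n * ∫ ω', U 0 ω' ∂P| ≤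
      |∑ i ∈ Finset.range (n / τ), blockDev P U τ i ω| + (τ - 1) * B := by
  obtain ⟨h0, h1⟩ := integral_mem_Icc hU hB
  set e := ∫ ω', U 0 ω' ∂P with he
  have hblocks : ∀ q ω, ∑ i ∈ Finset.range q, blockDev P U τ i ω =
      ∑ j ∈ Finset.range (q * τ), U j ω - (q * τ : ℕ) * e := by
    intro q ω
    induction q with
    | zero => simp
    | succ q ih =>
      rw [Finset.sum_range_succ, ih, Nat.succ_mul, Finset.sum_range_add, blockDev]
      push_cast
      ring
  have hr : n % τ ≤ τ - 1 := by have := Nat.mod_lt n hτ; omega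
  have hr' : ((n % τ : ℕ) : ℝ) ≤ τ - 1 := by
    rw [← Nat.cast_one, ← Nat.cast_sub hτ]; exact_mod_cast hr
  have hB0 : 0 ≤ B := h0.trans h1
  filter_upwards [sum_mem_Icc_ae hB (n / τ * τ) (n % τ)] with ω hω
  have hn : n = n / τ * τ + n % τ := by rw [mul_comm]; exact (Nat.div_add_mod n τ).symm
  have h2 : ∑ j ∈ Finset.range n, U j ω - n * e =
      ∑ i ∈ Finset.range (n / τ), blockDev P U τ i ω +
        (∑ j ∈ Finset.range (n % τ), U (n / τ * τ + j) ω - (n % τ : ℕ) * e) := by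
    rw [hblocks]
    conv_lhs => rw [hn, Finset.sum_range_add]
    push_cast
    ring
  rw [h2]
  refine (abs_add_le _ _).trans (add_le_add le_rfl ?_)
  have h3 : ((n % τ : ℕ) : ℝ) * B ≤ (τ - 1) * B := by gcongr
  have h4 : 0 ≤ ((n % τ : ℕ) : ℝ) * e := by positivity
  have h5 : ((n % τ : ℕ) : ℝ) * e ≤ (n % τ : ℕ) * B := by gcongr
  rw [abs_le]
  constructor <;> linarith [hω.1, hω.2]

/-- Deviation of the sum of the first `n` terms, for any `τ` at which the process is `α`-mixing at level
`a`. -/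
theorem measureReal_abs_sum_sub_le (hU : ∀ j, Measurable (U j))
    (hstat : IsStationaryProcess P U) (hB : ∀ j, ∀ᵐ ω ∂P, U j ω ∈ Set.Icc 0 B) (hB0 : 0 < B)
    {τ : ℕ} (hτ : 1 ≤ τ) {a : ℝ} (ha : 0 ≤ a)
    (hα : ∀ t s, t + τ ≤ s → AlphaClose P (pastSigma U t) (futureSigma U s) a)
    {δ : ℝ} (hδ : 0 < δ) (hδ1 : 4 * δ < 1) (n : ℕ) :
    P.real {ω | Real.sqrt (4 * τ * blockVariance P U τ * Real.log (1 / δ) * n) +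
        4 / 3 * B * τ * Real.log (1 / δ) <
          |∑ j ∈ Finset.range n, U j ω - n * ∫ ω', U 0 ω' ∂P|} ≤ 4 * δ + n * a := by
  have hL : 0 < Real.log (1 / δ) := Real.log_pos (by rw [lt_div_iff₀ hδ]; linarith)
  set L := Real.log (1 / δ)
  have hv := blockVariance_nonneg (P := P) (U := U) τ
  have hq : n / τ * τ ≤ n := Nat.div_mul_le_self n τ
  have hq' : ((n / τ : ℕ) : ℝ) * τ ≤ n := by exact_mod_cast hq
  have hsqrt : Real.sqrt (4 * (n / τ : ℕ) * (τ ^ 2 * blockVariance P U τ) * L) ≤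
      Real.sqrt (4 * τ * blockVariance P U τ * L * n) := by
    apply Real.sqrt_le_sqrt
    rw [show 4 * ((n / τ : ℕ) : ℝ) * (τ ^ 2 * blockVariance P U τ) * L =
      4 * τ * blockVariance P U τ * L * ((n / τ : ℕ) * τ) by ring]
    gcongr
  have mono : ∀ E F : Set Ω, (∀ᵐ ω ∂P, ω ∈ E → ω ∈ F) → P.real E ≤ P.real F := fun E F h =>
    ENNReal.toReal_mono (measure_ne_top _ _) (measure_mono_ae h)
  rcases hτ.eq_or_lt with rfl | hτ2
  · refine (mono _ _ ?_).trans
      ((measureReal_abs_sum_blockDev_one_le hU hstat hB hB0 ha hα hδ (by linarith) n))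
    filter_upwards [abs_sum_sub_le_ae hU hB le_rfl n] with ω h1 h2
    simp only [Nat.div_one, Nat.cast_one, mul_one, sub_self, zero_mul, add_zero]
      at h1 h2 ⊢
    refine lt_of_eq_of_lt ?_ (h2.trans_le h1)
    congr 2
    ring
  · refine (mono _ _ ?_).trans ((measureReal_abs_sum_blockDev_le hU hstat hB hB0 hτ2 ha hα hδ
      hδ1 (n / τ)).trans ?_)
    · filter_upwards [abs_sum_sub_le_ae hU hB hτ n] with ω h1 h2
      change _ < _ at h2
      linarith
    · have h2 : (2 : ℝ) ≤ τ := by exact_mod_cast hτ2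
      have : 2 * ((n / τ : ℕ) : ℝ) ≤ n := by
        refine le_trans ?_ hq'
        rw [mul_comm]; gcongr
      gcongr

end Blocks

/-! ### Deviation bounds for the empirical mean -/

theorem one_sub_le_measureReal {Ω : Type*} [MeasurableSpace Ω] {P : Measure Ω}
    [IsProbabilityMeasure P] {E F : Set Ω} {p : ℝ} (hF : P.real F ≤ p)
    (h : ∀ ω, ω ∉ F → ω ∈ E) : 1 - p ≤ P.real E := by
  have h1 : P.real Set.univ ≤ P.real E + P.real F :=
    (measureReal_mono fun ω _ => by
      by_cases hω : ω ∈ F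
      · exact Or.inr hω
      · exact Or.inl (h ω hω)).trans (measureReal_union_le E F)
  rw [probReal_univ] at h1
  linarith

/-- Solving a self-bounding deviation inequality: `S ≥ 36 A` forces `X ≤ 4 S`. -/
theorem abs_sub_le_of_self_bounding {X S A : ℝ} (hX : 0 ≤ X) (hA : 0 ≤ A) (hS : 36 * A ≤ S)
    (h : |S - X| ≤ Real.sqrt (4 * (A * X)) + 4 / 3 * A) : |S - X| ≤ 82 * Real.sqrt (A * S) := by
  have hS0 : 0 ≤ S := by linarith
  obtain ⟨x, hx, rfl⟩ : ∃ x, 0 ≤ x ∧ X = x ^ 2 := ⟨√X, Real.sqrt_nonneg _, (Real.sq_sqrt hX).symm⟩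
  obtain ⟨s, hs, rfl⟩ : ∃ x, 0 ≤ x ∧ S = x ^ 2 := ⟨√S, Real.sqrt_nonneg _, (Real.sq_sqrt hS0).symm⟩
  obtain ⟨u, hu, rfl⟩ : ∃ x, 0 ≤ x ∧ A = x ^ 2 := ⟨√A, Real.sqrt_nonneg _, (Real.sq_sqrt hA).symm⟩
  rw [show 4 * (u ^ 2 * x ^ 2) = (2 * u * x) ^ 2 by ring, Real.sqrt_sq (by positivity)] at h
  rw [← mul_pow, Real.sqrt_sq (by positivity)]
  have hus : 6 * u ≤ s := by
    refine le_of_sq_le_sq ?_ hs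
    linarith [mul_pow 6 u 2]
  have hxs : x ≤ 2 * s := by
    by_contra hc
    have h1 := (abs_le.1 h).1
    nlinarith
  nlinarith

/-- The process `U₁, U₂, …` is `U 0, U 1, …`, so that `U_j` is `U (j - 1)`. -/
theorem lemma2 {Ω : Type*} [MeasurableSpace Ω] (P : Measure Ω) [IsProbabilityMeasure P]
    (U : ℕ → Ω → ℝ) (hU : ∀ j, Measurable (U j)) (hstat : IsStationaryProcess P U)
    (μ ρ : ℝ) (hmix : IsExpAlphaMixing P U μ ρ)
    (B : ℝ) (hB : ∀ j, ∀ᵐ ω ∂P, U j ω ∈ Set.Icc 0 B)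
    (n : ℕ) (hn : 1 ≤ n) (δ ε : ℝ) (hδ : 0 < δ) (hε : 0 < ε) :
    (∀ τ : ℕ, mixingTime P U (ε / n) ≤ τ →
      1 - 4 * δ - ε ≤ P.real {ω |
        |(∫ ω', U 0 ω' ∂P) - 1 / (n : ℝ) * ∑ j ∈ Finset.range n, U j ω| ≤
          Real.sqrt (4 * (τ : ℝ) * blockVariance P U τ * Real.log (1 / δ) / n)
            + 4 * B * (τ : ℝ) * Real.log (1 / δ) / (3 * n)}) ∧
    (24 * mixingTime P U (ε / n) ≤ n →
      1 - 10 * δ - 2 * ε ≤ P.real {ω |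
        36 * B * Real.log (2 / δ) * (mixingTime P U (ε / n) : ℝ)
            ≤ ∑ j ∈ Finset.range n, U j ω →
          |(∫ ω', U 0 ω' ∂P) - 1 / (n : ℝ) * ∑ j ∈ Finset.range n, U j ω| ≤
            82 * (Real.sqrt (B * Real.log (2 / δ) * (∑ j ∈ Finset.range n, U j ω)
              * (mixingTime P U (ε / n) : ℝ)) / n)}) := by
  have hn0 : (0 : ℝ) < n := by exact_mod_cast hn
  have hη : 0 < ε / n := by positivity
  obtain ⟨hT1, hTα⟩ := hmix.mixingTime_spec hη
  set T := mixingTime P U (ε / n)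
  obtain ⟨he0, heB⟩ := integral_mem_Icc hU hB
  have hB0 : 0 ≤ B := he0.trans heB
  have hα : ∀ τ, T ≤ τ → ∀ t s, t + τ ≤ s →
      AlphaClose P (pastSigma U t) (futureSigma U s) (ε / n) := fun τ hτ t s hts A A' hA hA' =>
    (alphaClose_pastSigma_futureSigma P U (τ := T) (by omega) A A' hA hA').trans hTα
  have tail : ∀ τ, T ≤ τ → 4 * δ < 1 →
      P.real {ω | Real.sqrt (4 * τ * blockVariance P U τ * Real.log (1 / δ) * n) +
        4 / 3 * B * τ * Real.log (1 / δ) <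
          |∑ j ∈ Finset.range n, U j ω - n * ∫ ω', U 0 ω' ∂P|} ≤ 4 * δ + ε := by
    intro τ hτ hδ1
    rcases hB0.eq_or_lt with h0 | h0
    · have hz : P {ω | Real.sqrt (4 * τ * blockVariance P U τ * Real.log (1 / δ) * n) +
          4 / 3 * B * τ * Real.log (1 / δ) <
          |∑ j ∈ Finset.range n, U j ω - n * ∫ ω', U 0 ω' ∂P|} = 0 := by
        refine measure_eq_zero_iff_ae_notMem.2 ?_
        filter_upwards [sum_mem_Icc_ae hB 0 n] with ω hω
        have h1 : ∑ j ∈ Finset.range n, U j ω = 0 := by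
          simpa [← h0] using hω
        have h2 : ∫ ω', U 0 ω' ∂P = 0 := le_antisymm (by linarith) he0
        simp only [not_lt]
        rw [h1, h2, ← h0]
        simp
      rw [measureReal_def, hz]
      simp only [ENNReal.toReal_zero]
      positivity
    · have := measureReal_abs_sum_sub_le hU hstat hB h0 (hT1.trans hτ) hη.le (hα τ hτ) hδ hδ1 n
      rwa [mul_div_cancel₀ _ hn0.ne'] at this
  have scale : ∀ ω, |(∫ ω', U 0 ω' ∂P) - 1 / (n : ℝ) * ∑ j ∈ Finset.range n, U j ω| =
      |∑ j ∈ Finset.range n, U j ω - n * ∫ ω', U 0 ω' ∂P| / n := fun ω => by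
    rw [abs_sub_comm, eq_div_iff hn0.ne', ← abs_of_pos hn0, ← abs_mul, abs_of_pos hn0]
    congr 1
    field_simp
  constructor
  · intro τ hτ
    rcases lt_or_ge (4 * δ) 1 with hδ1 | hδ1
    · rw [sub_sub]
      refine one_sub_le_measureReal (tail τ hτ hδ1) fun ω hω => ?_
      simp only [Set.mem_ofPred_eq, not_lt] at hω ⊢
      rw [scale, div_le_iff₀ hn0]
      refine hω.trans_eq ?_
      rw [add_mul]
      congr 1
      · rw [show 4 * τ * blockVariance P U τ * Real.log (1 / δ) * n =
          4 * τ * blockVariance P U τ * Real.log (1 / δ) / n * (n : ℝ) ^ 2 by field_simp,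
          Real.sqrt_mul' _ (by positivity), Real.sqrt_sq hn0.le]
      · field_simp
    · linarith [measureReal_nonneg (μ := P) (s := {ω |
        |(∫ ω', U 0 ω' ∂P) - 1 / (n : ℝ) * ∑ j ∈ Finset.range n, U j ω| ≤
          Real.sqrt (4 * (τ : ℝ) * blockVariance P U τ * Real.log (1 / δ) / n)
            + 4 * B * (τ : ℝ) * Real.log (1 / δ) / (3 * n)})]
  · intro _
    rcases lt_or_ge (4 * δ) 1 with hδ1 | hδ1
    · refine le_trans (by linarith) (one_sub_le_measureReal (tail T le_rfl hδ1) fun ω hω => ?_)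
      simp only [Set.mem_ofPred_eq, not_lt] at hω ⊢
      intro hS
      have hL1 : 0 < Real.log (1 / δ) := Real.log_pos (by rw [lt_div_iff₀ hδ]; linarith)
      have hL : Real.log (1 / δ) ≤ Real.log (2 / δ) :=
        Real.log_le_log (by positivity) (by gcongr; norm_num)
      have hv := blockVariance_le hU hstat hB hT1
      rw [scale, ← mul_div_assoc]
      gcongr
      have hA : 0 ≤ B * Real.log (2 / δ) * T := by
        have := hL1.trans_le hL
        positivity
      have := abs_sub_le_of_self_bounding (X := n * ∫ ω', U 0 ω' ∂P)
        (S := ∑ j ∈ Finset.range n, U j ω) (A := B * Real.log (2 / δ) * T) (by positivity) hA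
        (by linarith) (hω.trans ?_)
      · refine this.trans_eq ?_
        congr 2
        ring
      · have hv0 := blockVariance_nonneg (P := P) (U := U) T
        refine add_le_add (Real.sqrt_le_sqrt ?_) ?_
        · calc 4 * T * blockVariance P U T * Real.log (1 / δ) * n
              ≤ 4 * T * (B * ∫ ω', U 0 ω' ∂P) * Real.log (2 / δ) * n := by gcongr
            _ = _ := by ring
        · calc 4 / 3 * B * T * Real.log (1 / δ) ≤ 4 / 3 * B * T * Real.log (2 / δ) := by gcongr
            _ = _ := by ring
    · have := measureReal_nonneg (μ := P) (s := {ω |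
        36 * B * Real.log (2 / δ) * (T : ℝ) ≤ ∑ j ∈ Finset.range n, U j ω →
          |(∫ ω', U 0 ω' ∂P) - 1 / (n : ℝ) * ∑ j ∈ Finset.range n, U j ω| ≤
            82 * (Real.sqrt (B * Real.log (2 / δ) * (∑ j ∈ Finset.range n, U j ω)
              * (T : ℝ)) / n)})
      linarith
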